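/- **Conventions.** A structured matrix $\bar M\in\{0,*\}^{k\times l}$ has entries that are either fixed zeros or free real parameters $*$, all independent; a realization is a real matrix obtained by assigning values to the $n_{\bar M}$ entries $*$, so realizations correspond to points of $\mathbb R^{n_{\bar M}}$. A proper variety in $\mathbb R^d$ is the solution set of a system of polynomial equations that is not all of $\mathbb R^d$. The generic rank $\operatorname{grank}\bar M$ is the maximum rank of the realizations of $\bar M$; $[\bar M_1;\bar M_2;\dots]$ denotes vertical stacking. Let $\bar A\in\{0,*\}^{n\times n}$, $\bar C\in\{0,*\}^{p\times n}$, $\bar F\in\{0,*\}^{r\times n}$. * $\bar A$ is *generically diagonalizable* if there is a proper variety $\mathbb V\subseteq\mathbb R^{n_{\bar A}}$ such that every realization $A\notin\mathbb V$ is diagonalizable (over $\mathbb C$). * A real triple $(A,C,F)$ is *functionally observable* if, for the system $\dot x=Ax+Bu$, $y=Cx$ (with any input matrix $B$), for every initial state $x(0)$ and input $u$ there is a finite time $T$ such that $Fx(0)$ is uniquely determined by $y(t)$ and $u(t)$, $0\le t\le T$. The triple $(\bar A,\bar C,\bar F)$ is *structurally functionally observable* (SFO) if there is a proper variety $\mathbb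 V\subseteq\mathbb R^{n_{\bar A}}\times\mathbb R^{n_{\bar C}}\times\mathbb R^{n_{\bar F}}$ such that all realizations $(A,C,F)\notin\mathbb V$ are functionally observable. * $\mathcal G(\bar A,\bar C)$ is the digraph with state vertices $X=\{x_1,\dots,x_n\}$, output vertices $y_1,\dots,y_p$, an edge $(x_i,x_j)$ whenever $\bar A_{ji}\neq0$, and an edge $(x_i,y_j)$ whenever $\bar C_{ji}\ne0$. A state vertex is *output-reachable* if there is a path from it to some output vertex. A *dilation* is a set $X_s\subseteq X$ having fewer than $|X_s|$ out-neighbours in $\mathcal G(\bar A,\bar C)$; a *minimal dilation* is a dilation none of whose proper subsets is a dilation. * $X_F=\{x_i:\bar F(:,i)\neq0\}$ is the set of *functional states*, and $\bar e_i\in\{0,*\}^{1\times n}$ is the structured row whose $i$-th entry is $*$ and whose other entries are $0$. **Theorem.** Suppose $\bar A$ is generically diagonalizable. Then the following statements are equivalent: (a) $(\bar A,\bar C,\bar F)$ is structurally functionally observable. (b) Every $x\in X_F$ is output-reachable, and $\operatorname{grank}[\bar A;\bar C]=\operatorname{grank}[\bar A;\bar C;\bar F]$. (c) Every $x\in X_F$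 is output-reachable, and $\operatorname{grank}[\bar A;\bar C]=\operatorname{grank}[\bar A;\bar C;\bar e_i]$ for each $x_i\in X_F$. (d) Every $x\in X_F$ is output-reachable, and no $x\in X_F$ is contained in a minimal dilation of $\mathcal G(\bar A,\bar C)$. -/

import Mathlib

open MeasureTheory

noncomputable section

namespace StructSys

/-! ### Structured matrices, realizations, proper varieties, generic rank -/

/-- A structured matrix: `true` is a free parameter `*`, `false` is a fixed zero. -/
abbrev SMatrix (ι κ : Type) : Type := Matrix ι κ Bool

/-- The positions of the free parameters of `M`. Its cardinality is `n_M`, and `Stars M → ℝ`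
is the parameter space `ℝ^{n_M}`. -/
abbrev Stars {ι κ : Type} (M : SMatrix ι κ) : Type :=
  {ij : ι × κ // M ij.1 ij.2 = true}

/-- The realization of `M` with parameter values `θ`. -/
def realize {ι κ : Type} (M : SMatrix ι κ) (θ : Stars M → ℝ) : Matrix ι κ ℝ :=
  fun i j => if h : M i j = true then θ ⟨(i, j), h⟩ else 0

/-- An algebraic variety in `ℝ^σ` other than the whole space. -/
def IsProperVariety {σ : Type} (V : Set (σ → ℝ)) : Prop :=
  (∃ P : Set (MvPolynomial σ ℝ), V = {x | ∀ f ∈ P, MvPolynomial.eval x f = 0}) ∧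
    V ≠ Set.univ

/-- The generic rank: the maximum rank of the realizations of `M`. -/
def grank {ι κ : Type} [Fintype κ] (M : SMatrix ι κ) : ℕ :=
  sSup (Set.range fun θ : Stars M → ℝ => (realize M θ).rank)

/-- The supremum in `grank` is an attained maximum. -/
theorem isGreatest_grank {ι κ : Type} [Fintype κ] (M : SMatrix ι κ) :
    IsGreatest (Set.range fun θ : Stars M → ℝ => (realize M θ).rank) (grank M) := by
  have hb : BddAbove (Set.range fun θ : Stars M → ℝ => (realize M θ).rank) := by
    refine ⟨Fintype.card κ, ?_⟩
    rintro _ ⟨θ, rfl⟩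
    exact Matrix.rank_le_card_width _
  exact ⟨Nat.sSup_mem ⟨_, 0, rfl⟩ hb, fun _ h => le_csSup hb h⟩

/-- `[M; N]`, the matrix `M` stacked on top of `N`. -/
abbrev stack {ι₁ ι₂ κ : Type} (M : SMatrix ι₁ κ) (N : SMatrix ι₂ κ) : SMatrix (ι₁ ⊕ ι₂) κ :=
  Matrix.fromRows M N

/-- The structured row whose `i`-th entry is `*` and whose other entries are zero. -/
def unitRow {n : ℕ} (i : Fin n) : SMatrix (Fin 1) (Fin n) :=
  fun _ j => decide (j = i)

/-! ### Generic diagonalizability -/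

/-- A real square matrix is diagonalizable (over `ℂ`). -/
def IsDiagonalizable {n : ℕ} (A : Matrix (Fin n) (Fin n) ℝ) : Prop :=
  ∃ (P : Matrix (Fin n) (Fin n) ℂ) (d : Fin n → ℂ),
    IsUnit P ∧ A.map Complex.ofReal * P = P * Matrix.diagonal d

/-- Almost all realizations are diagonalizable. -/
def GenericallyDiagonalizable {n : ℕ} (A : SMatrix (Fin n) (Fin n)) : Prop :=
  ∃ V : Set (Stars A → ℝ), IsProperVariety V ∧
    ∀ θ : Stars A → ℝ, θ ∉ V → IsDiagonalizable (realize A θ)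

/-! ### Functional observability -/

/-- Admissible inputs on `[0, ∞)`: locally integrable ones. -/
def IsInput {m : ℕ} (u : ℝ → Fin m → ℝ) : Prop :=
  ∀ t : ℝ, 0 ≤ t → IntervalIntegrable u volume 0 t

/-- `x` is the state trajectory on `[0, ∞)` of `ẋ(t) = A x(t) + B u(t)`, `x(0) = x₀`
(in integrated form, since `u` need not be continuous). -/
def IsTrajectory {n m : ℕ} (A : Matrix (Fin n) (Fin n) ℝ) (B : Matrix (Fin n) (Fin m) ℝ)
    (u : ℝ → Fin m → ℝ) (x₀ : Fin n → ℝ) (x : ℝ → Fin n → ℝ) : Prop :=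
  ContinuousOn x (Set.Ici 0) ∧
    ∀ t : ℝ, 0 ≤ t → x t = x₀ + ∫ s in (0 : ℝ)..t, (A.mulVec (x s) + B.mulVec (u s))

/-- The system `ẋ = A x + B u`, `y = C x`, `z = F x` is functionally observable: for any initial
state `x₀` and input `u` there is a finite time `T` such that every initial state which is
compatible with the input and the output on `[0, T]` has the same value of `F x(0)`. -/
def SystemFunctionallyObservable {n m p r : ℕ} (A : Matrix (Fin n) (Fin n) ℝ)
    (B : Matrix (Fin n) (Fin m) ℝ) (C : Matrix (Fin p) (Fin n) ℝ)
    (F : Matrix (Fin r) (Fin n) ℝ) : Prop :=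
  ∀ (x₀ : Fin n → ℝ) (u : ℝ → Fin m → ℝ), IsInput u →
    ∃ T : ℝ, 0 < T ∧
      ∀ (x₁ : Fin n → ℝ) (x x' : ℝ → Fin n → ℝ),
        IsTrajectory A B u x₀ x → IsTrajectory A B u x₁ x' →
        (∀ t ∈ Set.Icc 0 T, C.mulVec (x t) = C.mulVec (x' t)) →
        F.mulVec x₀ = F.mulVec x₁

/-- The triple `(A, C, F)` is functionally observable (whatever the input matrix `B` is). -/
def FunctionallyObservable {n p r : ℕ} (A : Matrix (Fin n) (Fin n) ℝ)
    (C : Matrix (Fin p) (Fin n) ℝ) (F : Matrix (Fin r) (Fin n) ℝ) : Prop :=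
  ∀ (m : ℕ) (B : Matrix (Fin n) (Fin m) ℝ), SystemFunctionallyObservable A B C F

/-- Structural functional observability: almost all realizations of `(A, C, F)`, with respect to
the joint parameter space, are functionally observable. -/
def SFO {n p r : ℕ} (A : SMatrix (Fin n) (Fin n)) (C : SMatrix (Fin p) (Fin n))
    (F : SMatrix (Fin r) (Fin n)) : Prop :=
  ∃ V : Set (Stars A ⊕ Stars C ⊕ Stars F → ℝ), IsProperVariety V ∧
    ∀ θ : Stars A ⊕ Stars C ⊕ Stars F → ℝ, θ ∉ V →
      FunctionallyObservable
        (realize A fun s => θ (Sum.inl s))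
        (realize C fun s => θ (Sum.inr (Sum.inl s)))
        (realize F fun s => θ (Sum.inr (Sum.inr s)))

/-! ### The digraph of `(A, C)`, output-reachability, dilations -/

/-- The digraph `𝒢(A, C)` on the state vertices `Sum.inl i` and the output vertices `Sum.inr k`. -/
def systemDigraph {n p : ℕ} (A : SMatrix (Fin n) (Fin n)) (C : SMatrix (Fin p) (Fin n)) :
    Digraph (Fin n ⊕ Fin p) where
  Adj
    | Sum.inl i, Sum.inl j => A j i = true
    | Sum.inl i, Sum.inr k => C k i = true
    | Sum.inr _, _ => False

/-- There is a path from the state vertex `x_i` to some output vertex. -/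
def OutputReachable {n p : ℕ} (A : SMatrix (Fin n) (Fin n)) (C : SMatrix (Fin p) (Fin n))
    (i : Fin n) : Prop :=
  ∃ k : Fin p, Relation.ReflTransGen (systemDigraph A C).Adj (Sum.inl i) (Sum.inr k)

/-- The set of (indices of) functional states: nonzero columns of `F`. -/
def functionalStates {n r : ℕ} (F : SMatrix (Fin r) (Fin n)) : Set (Fin n) :=
  {i | ∃ k : Fin r, F k i = true}

/-- The set of out-neighbours of a set of state vertices. -/
def outNeighbors {n p : ℕ} (A : SMatrix (Fin n) (Fin n)) (C : SMatrix (Fin p) (Fin n))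
    (S : Set (Fin n)) : Set (Fin n ⊕ Fin p) :=
  {v | ∃ i ∈ S, (systemDigraph A C).Adj (Sum.inl i) v}

/-- A dilation: a set of state vertices with fewer out-neighbours than elements. -/
def IsDilation {n p : ℕ} (A : SMatrix (Fin n) (Fin n)) (C : SMatrix (Fin p) (Fin n))
    (S : Set (Fin n)) : Prop :=
  (outNeighbors A C S).ncard < S.ncard

/-- A dilation none of whose proper subsets is a dilation. -/
def IsMinimalDilation {n p : ℕ} (A : SMatrix (Fin n) (Fin n)) (C : SMatrix (Fin p) (Fin n))
    (S : Set (Fin n)) : Prop :=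
  IsDilation A C S ∧ ∀ S' : Set (Fin n), S' ⊂ S → ¬ IsDilation A C S'

end StructSys

end

/-! Functional observability of a real triple means that `F` kills the unobservable subspace of `(A,
C)`. When `A` is diagonalizable, that subspace is spanned by eigenvectors of `A` annihilated by `C`,
so the generic question splits by eigenvalue.

For eigenvalue 0 these eigenvectors form the kernel of `[A; C]`. Generically this kernel vanishes at
the functional states exactly when appending `F` leaves the generic rank unchanged
(`grank_eq_grank_stack_iff_vanish`). This can be tested state by state, and by Hall's theorem and a
minimal-support argument it means avoiding minimal dilations (`ker_vanish_iff_no_minimalDilation`).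

For nonzero eigenvalues output-reachability suffices
(`generic_eigenvector_eq_zero_of_outputReachable`). Keep only the output-reachable rows of `A`. A
common divisor of the characteristic polynomial and of the determinants of `x - A` with row `i`
replaced by a row of `C` contains no parameter: the characteristic polynomial omits those of `C` and
of the deleted rows, and the `i`-th determinants, nonzero for a suitable output when `i` is
reachable, omit those of row `i`. Setting all parameters to zero shows that it divides `x ^ n`. By
Gauss's lemma a nonzero parameter polynomial times `x ^ n` then lies in the ideal they generate,
which excludes nonzero invisible modes on the reachable part.

Conversely, kernel vectors of `[A; C]` and unit vectors of unreachable states are always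
unobservable. -/

noncomputable section

namespace StructSys

/-! ### Generic properties -/

/-- `Q` holds wherever some nonzero polynomial does not vanish. -/
def Generic {σ : Type} (Q : (σ → ℝ) → Prop) : Prop :=
  ∃ f : MvPolynomial σ ℝ, f ≠ 0 ∧ ∀ θ : σ → ℝ, MvPolynomial.eval θ f ≠ 0 → Q θ

namespace Generic

variable {σ τ : Type} {Q Q' : (σ → ℝ) → Prop}

theorem mono (h : Generic Q) (hQ : ∀ θ, Q θ → Q' θ) : Generic Q' := by
  obtain ⟨f, hf, h⟩ := h
  exact ⟨f, hf, fun θ hθ => hQ θ (h θ hθ)⟩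

theorem and (h : Generic Q) (h' : Generic Q') : Generic fun θ => Q θ ∧ Q' θ := by
  obtain ⟨f, hf, h⟩ := h
  obtain ⟨f', hf', h'⟩ := h'
  refine ⟨f * f', mul_ne_zero hf hf', fun θ hθ => ?_⟩
  rw [map_mul] at hθ
  exact ⟨h θ (left_ne_zero_of_mul hθ), h' θ (right_ne_zero_of_mul hθ)⟩

theorem of_forall (h : ∀ θ, Q θ) : Generic Q :=
  ⟨1, one_ne_zero, fun θ _ => h θ⟩

theorem all {ι : Type} [Finite ι] {Q : ι → (σ → ℝ) → Prop} (h : ∀ i, Generic (Q i)) :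
    Generic fun θ => ∀ i, Q i θ := by
  cases nonempty_fintype ι
  choose f hf h using h
  refine ⟨∏ i, f i, Finset.prod_ne_zero_iff.2 fun i _ => hf i, fun θ hθ i => h i θ ?_⟩
  rw [map_prod] at hθ
  exact Finset.prod_ne_zero_iff.1 hθ i (Finset.mem_univ i)

theorem _root_.MvPolynomial.exists_eval_ne_zero {f : MvPolynomial σ ℝ} (hf : f ≠ 0) :
    ∃ θ : σ → ℝ, MvPolynomial.eval θ f ≠ 0 := by
  by_contra! h
  exact hf (MvPolynomial.funext fun θ => by rw [h θ, map_zero])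

theorem exists_point (h : Generic Q) : ∃ θ, Q θ := by
  obtain ⟨f, hf, h⟩ := h
  obtain ⟨θ, hθ⟩ := MvPolynomial.exists_eval_ne_zero hf
  exact ⟨θ, h θ hθ⟩

/-- Carries a generic property of one block to a joint parameter space. -/
theorem comp_injective (h : Generic Q) {e : σ → τ} (he : Function.Injective e) :
    Generic fun θ : τ → ℝ => Q fun s => θ (e s) := by
  obtain ⟨f, hf, h⟩ := h
  refine ⟨MvPolynomial.rename e f, ?_, fun θ hθ => h _ ?_⟩
  · rwa [Ne, map_eq_zero_iff _ (MvPolynomial.rename_injective e he)]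
  · rwa [MvPolynomial.eval_rename] at hθ

end Generic

/-- One equation that does not vanish identically already suffices to bound a proper variety. -/
theorem exists_properVariety_iff_generic {σ : Type} (Q : (σ → ℝ) → Prop) :
    (∃ V : Set (σ → ℝ), IsProperVariety V ∧ ∀ θ, θ ∉ V → Q θ) ↔ Generic Q := by
  constructor
  · rintro ⟨V, ⟨⟨P, rfl⟩, hV⟩, h⟩
    obtain ⟨x, hx⟩ := (Set.ne_univ_iff_exists_notMem _).1 hV
    simp only [Set.mem_ofPred_eq, not_forall] at hx
    obtain ⟨f, hf, hfx⟩ := hx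
    refine ⟨f, fun h0 => hfx (by rw [h0, map_zero]), fun θ hθ => h θ fun hmem => hθ (hmem f hf)⟩
  · rintro ⟨f, hf, h⟩
    refine ⟨{x | MvPolynomial.eval x f = 0}, ⟨⟨{f}, by simp⟩, ?_⟩, fun θ hθ => h θ hθ⟩
    obtain ⟨θ, hθ⟩ := MvPolynomial.exists_eval_ne_zero hf
    exact (Set.ne_univ_iff_exists_notMem _).2 ⟨θ, hθ⟩

/-! ### Realizations -/

/-- The realization with polynomial entries: every free parameter is an indeterminate. -/
def polyRealize {ι κ : Type} (M : SMatrix ι κ) : Matrix ι κ (MvPolynomial (Stars M) ℝ) :=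
  fun i j => if h : M i j = true then MvPolynomial.X ⟨(i, j), h⟩ else 0

theorem map_polyRealize {ι κ : Type} (M : SMatrix ι κ) (θ : Stars M → ℝ) :
    (polyRealize M).map (MvPolynomial.eval θ) = realize M θ := by
  ext i j
  by_cases h : M i j = true <;> simp [polyRealize, realize, h]

theorem realize_fromRows {ι₁ ι₂ κ : Type} (M : SMatrix ι₁ κ) (N : SMatrix ι₂ κ)
    (θ : Stars (stack M N) → ℝ) :
    realize (stack M N) θ = Matrix.fromRows
      (realize M fun s => θ ⟨(Sum.inl s.1.1, s.1.2), s.2⟩)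
      (realize N fun s => θ ⟨(Sum.inr s.1.1, s.1.2), s.2⟩) := by
  ext (i | i) j <;> rfl

/-- Parameters of the stacked matrix from parameters of the blocks. -/
def stackParam {ι₁ ι₂ κ : Type} {M : SMatrix ι₁ κ} {N : SMatrix ι₂ κ}
    (θ : Stars M → ℝ) (η : Stars N → ℝ) : Stars (stack M N) → ℝ
  | ⟨(Sum.inl i, j), h⟩ => θ ⟨(i, j), h⟩
  | ⟨(Sum.inr i, j), h⟩ => η ⟨(i, j), h⟩

theorem realize_stackParam {ι₁ ι₂ κ : Type} {M : SMatrix ι₁ κ} {N : SMatrix ι₂ κ}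
    (θ : Stars M → ℝ) (η : Stars N → ℝ) :
    realize (stack M N) (stackParam θ η) = Matrix.fromRows (realize M θ) (realize N η) := by
  ext (i | i) j <;> rfl

theorem exists_realize_eq {ι κ : Type} (M : SMatrix ι κ) (B : Matrix ι κ ℝ)
    (hB : ∀ i j, M i j = false → B i j = 0) : ∃ θ, realize M θ = B := by
  refine ⟨fun s => B s.1.1 s.1.2, ?_⟩
  ext i j
  by_cases h : M i j = true
  · simp [realize, h]
  · simp [realize, h, hB i j (by simpa using h)]

/-! ### Generic injectivity and generic rank -/

/-- Injectivity of `M W` is an open condition on the realization of `M`. -/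
theorem generic_mulVec_injective {ι κ τ : Type} [Fintype ι] [Fintype κ] [Fintype τ]
    (M : SMatrix ι κ) (W : Matrix κ τ ℝ) (θ₀ : Stars M → ℝ)
    (h : Function.Injective (realize M θ₀ * W).mulVec) :
    Generic fun θ => Function.Injective (realize M θ * W).mulVec := by
  classical
  obtain ⟨g, hg⟩ := LinearMap.exists_leftInverse_of_injective
    (realize M θ₀ * W).mulVecLin (LinearMap.ker_eq_bot.2 h)
  have hL : LinearMap.toMatrix' g * (realize M θ₀ * W) = 1 := by
    rw [← LinearMap.toMatrix'_id, ← hg, LinearMap.toMatrix'_comp]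
    congr 1
    exact (LinearMap.toMatrix'_toLin' _).symm
  set L := LinearMap.toMatrix' g
  -- With `L` a left inverse at `θ₀`, the square determinant of `L M W` equals 1 there, and wherever
  -- it is nonzero `M W` is injective.
  let d : MvPolynomial (Stars M) ℝ :=
    ((L.map MvPolynomial.C : Matrix τ ι (MvPolynomial (Stars M) ℝ)) *
      (polyRealize M * (W.map MvPolynomial.C : Matrix κ τ (MvPolynomial (Stars M) ℝ)))).det
  have hd : ∀ θ, MvPolynomial.eval θ d = (L * (realize M θ * W)).det := fun θ => by
    rw [RingHom.map_det, RingHom.mapMatrix_apply, Matrix.map_mul, Matrix.map_mul,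
      map_polyRealize, Matrix.map_map, Matrix.map_map]
    congr <;> ext <;> simp
  refine ⟨d, fun h0 => ?_, fun θ hθ v w hvw => ?_⟩
  · have := hd θ₀
    rw [h0, hL] at this
    simp at this
  · rw [hd] at hθ
    refine Matrix.mulVec_injective_of_isUnit ((Matrix.isUnit_iff_isUnit_det _).2 hθ.isUnit) ?_
    simp only [← Matrix.mulVec_mulVec] at hvw ⊢
    rw [hvw]

/-- The columns of `W` are preimages of a basis of the range, which turns a lower bound on rank into
injectivity. -/
theorem exists_mul_mulVec_injective {ι κ : Type} [Fintype ι] [Fintype κ] (B : Matrix ι κ ℝ) :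
    ∃ W : Matrix κ (Fin (Module.finrank ℝ (LinearMap.range B.mulVecLin))) ℝ,
      Function.Injective (B * W).mulVec := by
  classical
  let b := Module.finBasis ℝ (LinearMap.range B.mulVecLin)
  choose w hw using fun i => (b i).2
  refine ⟨Matrix.of fun j i => w i j, ?_⟩
  rw [Matrix.mulVec_injective_iff]
  have : (B * Matrix.of fun j i => w i j).col =
      fun i => ((b i : LinearMap.range B.mulVecLin) : ι → ℝ) := by
    funext i
    rw [← hw i]
    ext k
    simp [Matrix.col, Matrix.mul_apply, Matrix.mulVec, dotProduct]
  rw [this]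
  have h := b.linearIndependent.map' (LinearMap.range B.mulVecLin).subtype
    (Submodule.ker_subtype _)
  exact h

theorem generic_rank_le {ι κ : Type} [Fintype ι] [Fintype κ] (M : SMatrix ι κ)
    (θ₀ : Stars M → ℝ) : Generic fun θ => (realize M θ₀).rank ≤ (realize M θ).rank := by
  obtain ⟨W, hW⟩ := exists_mul_mulVec_injective (realize M θ₀)
  refine (generic_mulVec_injective M W θ₀ hW).mono fun θ hθ => ?_
  have h1 : (realize M θ * W).rank = (realize M θ₀).rank := by
    rw [Matrix.rank, LinearMap.finrank_range_of_inj hθ, Matrix.rank]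
    simp
  rw [← h1]
  exact Matrix.rank_mul_le_left _ _

theorem generic_grank {ι κ : Type} [Fintype ι] [Fintype κ] (M : SMatrix ι κ) :
    Generic fun θ => (realize M θ).rank = grank M := by
  obtain ⟨⟨θ₀, h₀⟩, hmax⟩ := isGreatest_grank M
  refine (generic_rank_le M θ₀).mono fun θ hθ => le_antisymm (hmax ⟨θ, rfl⟩) ?_
  rw [← h₀]
  exact hθ

theorem rank_realize_le {ι κ : Type} [Fintype κ] (M : SMatrix ι κ)
    (θ : Stars M → ℝ) : (realize M θ).rank ≤ grank M :=
  (isGreatest_grank M).2 ⟨θ, rfl⟩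

/-! ### Stacked matrices: ranks and kernels -/

theorem ker_fromRows {ι₁ ι₂ κ : Type} [Fintype κ] (M : Matrix ι₁ κ ℝ)
    (N : Matrix ι₂ κ ℝ) : LinearMap.ker (Matrix.fromRows M N).mulVecLin =
      LinearMap.ker M.mulVecLin ⊓ LinearMap.ker N.mulVecLin := by
  ext v
  simp only [LinearMap.mem_ker, Matrix.mulVecLin_apply, Matrix.fromRows_mulVec, Submodule.mem_inf]
  constructor
  · intro h
    exact ⟨funext fun i => congrFun h (Sum.inl i), funext fun i => congrFun h (Sum.inr i)⟩
  · rintro ⟨h1, h2⟩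
    rw [h1, h2]
    ext (i | i) <;> rfl

theorem rank_add_finrank_ker {ι κ : Type} [Fintype ι] [Fintype κ] (M : Matrix ι κ ℝ) :
    M.rank + Module.finrank ℝ (LinearMap.ker M.mulVecLin) = Fintype.card κ := by
  rw [Matrix.rank, LinearMap.finrank_range_add_finrank_ker]
  simp

theorem rank_le_rank_fromRows {ι₁ ι₂ κ : Type} [Fintype ι₁] [Fintype ι₂] [Fintype κ]
    (M : Matrix ι₁ κ ℝ) (N : Matrix ι₂ κ ℝ) : M.rank ≤ (Matrix.fromRows M N).rank := by
  have h1 := rank_add_finrank_ker M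
  have h2 := rank_add_finrank_ker (Matrix.fromRows M N)
  have h3 : Module.finrank ℝ (LinearMap.ker (Matrix.fromRows M N).mulVecLin) ≤
      Module.finrank ℝ (LinearMap.ker M.mulVecLin) :=
    Submodule.finrank_mono (by rw [ker_fromRows]; exact inf_le_left)
  omega

theorem ker_le_ker_iff_rank {ι₁ ι₂ κ : Type} [Fintype ι₁] [Fintype ι₂] [Fintype κ]
    (M : Matrix ι₁ κ ℝ) (N : Matrix ι₂ κ ℝ) :
    LinearMap.ker M.mulVecLin ≤ LinearMap.ker N.mulVecLin ↔
      M.rank = (Matrix.fromRows M N).rank := by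
  have h1 := rank_add_finrank_ker M
  have h2 := rank_add_finrank_ker (Matrix.fromRows M N)
  rw [← inf_eq_left, ← ker_fromRows]
  constructor
  · intro h
    rw [h] at h2
    omega
  · intro h
    refine Submodule.eq_of_le_of_finrank_eq (by rw [ker_fromRows]; exact inf_le_left) ?_
    omega

theorem grank_le_grank_stack {ι₁ ι₂ κ : Type} [Fintype ι₁] [Fintype ι₂] [Fintype κ]
    (M : SMatrix ι₁ κ) (N : SMatrix ι₂ κ) : grank M ≤ grank (stack M N) := by
  obtain ⟨θ, hθ⟩ := (isGreatest_grank M).1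
  simp only at hθ
  rw [← hθ]
  refine (rank_le_rank_fromRows _ (realize N 0)).trans ?_
  rw [← realize_stackParam]
  exact rank_realize_le _ _

/-- Equality of the generic ranks of `M` and `[M; N]` in terms of kernels. -/
theorem grank_eq_grank_stack_iff {ι₁ ι₂ κ : Type} [Fintype ι₁] [Fintype ι₂] [Fintype κ]
    (M : SMatrix ι₁ κ) (N : SMatrix ι₂ κ) :
    grank M = grank (stack M N) ↔ Generic fun θ : Stars M → ℝ => ∀ η : Stars N → ℝ,
      LinearMap.ker (realize M θ).mulVecLin ≤ LinearMap.ker (realize N η).mulVecLin := by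
  constructor
  · intro h
    refine (generic_grank M).mono fun θ hθ η => ?_
    rw [ker_le_ker_iff_rank]
    -- For every `η`, the stacked rank is at most `grank (stack M N)`, which is the rank already
    -- attained by `M` at `θ`.
    refine le_antisymm (rank_le_rank_fromRows _ _) ?_
    rw [hθ, h, ← realize_stackParam]
    exact rank_realize_le _ _
  · intro h
    let e : Stars M → Stars (stack M N) := fun s => ⟨(Sum.inl s.1.1, s.1.2), s.2⟩
    have he : Function.Injective e := fun s s' h => by
      have h := congrArg Subtype.val h
      exact Subtype.ext (Prod.ext (Sum.inl_injective (congrArg Prod.fst h))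
        (congrArg Prod.snd h :))
    obtain ⟨θ, h1, h2⟩ := ((generic_grank (stack M N)).and (h.comp_injective he)).exists_point
    refine le_antisymm (grank_le_grank_stack M N) ?_
    rw [← h1, realize_fromRows, ← (ker_le_ker_iff_rank _ _).1 (h2 _)]
    exact rank_realize_le _ _

/-- Appending `F` does not increase the generic rank iff generically the kernel vectors vanish at
the functional states of `F`. -/
theorem grank_eq_grank_stack_iff_vanish {ι : Type} [Fintype ι] {n r : ℕ}
    (M : SMatrix ι (Fin n)) (F : SMatrix (Fin r) (Fin n)) :
    grank M = grank (stack M F) ↔ Generic fun θ : Stars M → ℝ =>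
      ∀ v : Fin n → ℝ, (realize M θ).mulVec v = 0 → ∀ i ∈ functionalStates F, v i = 0 := by
  rw [grank_eq_grank_stack_iff]
  constructor
  · refine fun h => h.mono fun θ hθ v hv i ⟨k, hk⟩ => ?_
    -- A realization of `F` with a single nonzero entry isolates the coordinate `v i`.
    obtain ⟨η, hη⟩ := exists_realize_eq F (Matrix.single k i 1) fun a b hab => by
      rw [Matrix.single_apply_of_ne]
      rintro ⟨rfl, rfl⟩
      simp [hk] at hab
    have h0 : (Matrix.single k i (1 : ℝ)).mulVec v = 0 := by
      rw [← hη]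
      exact hθ η hv
    simpa [Matrix.mulVec, dotProduct, Matrix.single_apply] using congrFun h0 k
  · refine fun h => h.mono fun θ hθ η v hv => ?_
    rw [LinearMap.mem_ker, Matrix.mulVecLin_apply]
    ext k
    rw [Matrix.mulVec, dotProduct]
    refine Finset.sum_eq_zero fun i _ => ?_
    by_cases hk : F k i = true
    · rw [hθ v hv i ⟨k, hk⟩, mul_zero]
    · simp [realize, hk]

theorem functionalStates_unitRow {n : ℕ} (i : Fin n) : functionalStates (unitRow i) = {i} := by
  ext j
  simp [functionalStates, unitRow]

theorem grank_eq_grank_stack_iff_unitRow {ι : Type} [Fintype ι] {n r : ℕ}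
    (M : SMatrix ι (Fin n)) (F : SMatrix (Fin r) (Fin n)) :
    grank M = grank (stack M F) ↔
      ∀ i ∈ functionalStates F, grank M = grank (stack M (unitRow i)) := by
  simp only [grank_eq_grank_stack_iff_vanish, functionalStates_unitRow, Set.mem_singleton_iff,
    forall_eq]
  constructor
  · exact fun h i hi => h.mono fun θ hθ v hv => hθ v hv i hi
  · intro h
    refine (Generic.all (ι := functionalStates F) fun i => h i.1 i.2).mono ?_
    exact fun θ hθ v hv i hi => hθ ⟨i, hi⟩ v hv

/-! ### Dilations -/

section Dilation

variable {n p : ℕ} (A : SMatrix (Fin n) (Fin n)) (C : SMatrix (Fin p) (Fin n))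

theorem adj_iff_stack (i : Fin n) (v : Fin n ⊕ Fin p) :
    (systemDigraph A C).Adj (Sum.inl i) v ↔ stack A C v i = true := by
  cases v <;> rfl

/-- Generically the columns indexed by a set without dilations are independent. -/
theorem generic_eq_zero_of_no_dilation :
    Generic fun θ : Stars (stack A C) → ℝ => ∀ T : Set (Fin n),
      (∀ S ⊆ T, ¬ IsDilation A C S) → ∀ v : Fin n → ℝ,
        (realize (stack A C) θ).mulVec v = 0 → (∀ j ∉ T, v j = 0) → v = 0 := by
  classical
  refine Generic.all fun T => ?_
  by_cases hT : ∀ S ⊆ T, ¬ IsDilation A C S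
  swap
  · exact Generic.of_forall fun θ h => absurd h hT
  let t : T → Finset (Fin n ⊕ Fin p) := fun j => Finset.univ.filter fun v => stack A C v j = true
  -- Absence of dilations inside `T` is Hall's condition, so the columns in `T` are matched to
  -- distinct rows along free entries.
  obtain ⟨f, hf, hft⟩ := (Finset.all_card_le_biUnion_card_iff_exists_injective t).1 fun s => by
    have h := hT (Subtype.val '' (s : Set T)) (by simp)
    rw [IsDilation, not_lt, Set.ncard_image_of_injective _ Subtype.val_injective,
      Set.ncard_coe_finset] at h
    refine h.trans (le_of_eq ?_)
    rw [← Set.ncard_coe_finset]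
    congr 1
    ext v
    simp only [outNeighbors, adj_iff_stack, t]
    simp
  let W : Matrix (Fin n) T ℝ := Matrix.of fun j i => if j = i then 1 else 0
  have hW : ∀ (B : Matrix (Fin n ⊕ Fin p) (Fin n) ℝ) v j, (B * W) v j = B v j := by
    intro B v j
    simp [Matrix.mul_apply, W]
  -- The 0/1 matrix of the matching is a realization whose columns in `T` are independent.
  obtain ⟨θ₀, h₀⟩ := exists_realize_eq (stack A C)
    (Matrix.of fun v i => if ∃ h : i ∈ T, f ⟨i, h⟩ = v then 1 else 0) fun v i hvi => by
      simp only [Matrix.of_apply, ite_eq_right_iff, one_ne_zero, imp_false]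
      rintro ⟨h, rfl⟩
      simpa [t, hvi] using hft ⟨i, h⟩
  have hinj := generic_mulVec_injective (stack A C) W θ₀ (by
    rw [← Matrix.coe_mulVecLin, ← LinearMap.ker_eq_bot, LinearMap.ker_eq_bot']
    intro w hw
    ext j
    have := congrFun hw (f j)
    rw [Matrix.mulVecLin_apply, Matrix.mulVec, dotProduct, Finset.sum_eq_single j] at this
    · simpa [hW, h₀] using this
    · intro j' _ hj'
      rw [hW, h₀, Matrix.of_apply, if_neg, zero_mul]
      rintro ⟨_, h⟩
      exact hj' (hf h)
    · simp)
  refine hinj.mono fun θ hθ _ v hv hvT => ?_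
  have hWv : W.mulVec (fun j => v j) = v := by
    ext i
    by_cases hi : i ∈ T
    · rw [Matrix.mulVec, dotProduct, Finset.sum_eq_single ⟨i, hi⟩]
      · simp [W]
      · intro j _ hj
        have : i ≠ j := fun h => hj (Subtype.ext h.symm)
        simp [W, this]
      · simp
    · rw [hvT i hi, Matrix.mulVec, dotProduct]
      refine Finset.sum_eq_zero fun j _ => ?_
      have : i ≠ j := fun h => hi (h ▸ j.2)
      simp [W, this]
  have h0 : (fun j : T => v j) = 0 := hθ (by
    simp only [Matrix.mulVec_zero]
    rw [← Matrix.mulVec_mulVec, hWv, hv])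
  rw [← hWv, h0, Matrix.mulVec_zero]

/-- The columns indexed by a dilation are dependent. -/
theorem exists_ker_of_isDilation (θ : Stars (stack A C) → ℝ) {S : Set (Fin n)}
    (hS : IsDilation A C S) :
    ∃ v : Fin n → ℝ, v ≠ 0 ∧ (realize (stack A C) θ).mulVec v = 0 ∧ ∀ j ∉ S, v j = 0 := by
  classical
  -- All other rows vanish on `S`, and this block has more columns than rows.
  let B : Matrix (outNeighbors A C S) S ℝ := fun v j => realize (stack A C) θ v j
  obtain ⟨w, hw, hw0⟩ : ∃ w ∈ LinearMap.ker B.mulVecLin, w ≠ 0 := by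
    apply Submodule.exists_mem_ne_zero_of_ne_bot
    apply LinearMap.ker_ne_bot_of_finrank_lt
    rw [Module.finrank_fintype_fun_eq_card, Module.finrank_fintype_fun_eq_card,
      ← Nat.card_eq_fintype_card, ← Nat.card_eq_fintype_card]
    exact hS
  refine ⟨fun j => if h : j ∈ S then w ⟨j, h⟩ else 0, ?_, ?_, ?_⟩
  · refine fun h => hw0 (funext fun j => ?_)
    simpa using congrFun h j
  · ext v
    rw [Matrix.mulVec, dotProduct]
    by_cases hv : v ∈ outNeighbors A C S
    · have h1 := congrFun (LinearMap.mem_ker.1 hw) ⟨v, hv⟩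
      rw [Matrix.mulVecLin_apply, Matrix.mulVec, dotProduct] at h1
      refine Eq.trans ?_ h1
      refine (Fintype.sum_of_injective Subtype.val Subtype.val_injective _ _ ?_ ?_).symm
      · intro j hj
        rw [Subtype.range_coe] at hj
        rw [dif_neg hj, mul_zero]
      · intro j
        rw [dif_pos j.2]
    · refine Finset.sum_eq_zero fun j _ => ?_
      by_cases hj : j ∈ S
      · have : ¬ stack A C v j = true := fun h => hv ⟨j, hj, (adj_iff_stack A C j v).2 h⟩
        rw [realize, dif_neg this, zero_mul]
      · simp [hj]
  · intro j hj
    simp [hj]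

/-- A minimal dilation `S` carries a nonzero kernel vector; were it zero at `i ∈ S`, its support
would lie in the dilation-free set `S \ {i}`. Conversely, at a generic point, a kernel vector
nonzero at `i` with smallest support has a minimal dilation as support. -/
theorem ker_vanish_iff_no_minimalDilation (i : Fin n) :
    (Generic fun θ : Stars (stack A C) → ℝ =>
      ∀ v : Fin n → ℝ, (realize (stack A C) θ).mulVec v = 0 → v i = 0) ↔
    ¬ ∃ S : Set (Fin n), IsMinimalDilation A C S ∧ i ∈ S := by
  constructor
  · rintro h ⟨S, ⟨hS, hmin⟩, hi⟩
    obtain ⟨θ, h1, h2⟩ := (h.and (generic_eq_zero_of_no_dilation A C)).exists_point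
    obtain ⟨v, hv0, hv, hvS⟩ := exists_ker_of_isDilation A C θ hS
    refine hv0 (h2 (S \ {i}) (fun S' hS' => hmin S' ?_) v hv fun j hj => ?_)
    · exact ⟨hS'.trans Set.sdiff_subset, fun hss => (hS' (hss hi)).2 rfl⟩
    · by_cases hji : j = i
      · rw [hji]
        exact h1 v hv
      · exact hvS j fun hjS => hj ⟨hjS, hji⟩
  · intro h
    refine (generic_eq_zero_of_no_dilation A C).mono fun θ hθ => ?_
    by_contra! hcon
    let supp : (Fin n → ℝ) → Finset (Fin n) := fun v => Finset.univ.filter fun j => v j ≠ 0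
    have hsupp : ∀ v j, j ∈ supp v ↔ v j ≠ 0 := fun v j => by simp [supp]
    obtain ⟨v, ⟨hv, hvi⟩, hvmin⟩ := WellFounded.has_min
      (InvImage.wf (fun v => (supp v).card) (Nat.lt_wfRel.wf))
      {v : Fin n → ℝ | (realize (stack A C) θ).mulVec v = 0 ∧ v i ≠ 0} hcon
    -- If `w i = 0`, subtracting a multiple of `w` shrinks the support of `v` and keeps `v i`;
    -- otherwise `w` itself contradicts minimality.
    have circuit : ∀ w : Fin n → ℝ, (realize (stack A C) θ).mulVec w = 0 →
        supp w ⊂ supp v → w = 0 := by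
      intro w hw hlt
      by_contra hw0
      obtain ⟨j, hj⟩ := Function.ne_iff.1 hw0
      rw [Pi.zero_apply] at hj
      by_cases hwi : w i = 0
      · refine hvmin (v - (v j / w j) • w) ⟨?_, ?_⟩ (Finset.card_lt_card (?_ : _ ⊂ supp v))
        · rw [Matrix.mulVec_sub, Matrix.mulVec_smul, hv, hw, smul_zero, sub_zero]
        · simpa [hwi] using hvi
        · refine ⟨fun k hk => ?_, fun hss => ?_⟩
          · rw [hsupp] at hk ⊢
            intro hvk
            have hwk : w k = 0 := by
              by_contra hwk
              exact (hsupp v k).1 (hlt.1 ((hsupp w k).2 hwk)) hvk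
            simp [hvk, hwk] at hk
          · have := (hsupp _ j).1 (hss (hlt.1 ((hsupp w j).2 hj)))
            simp [hj] at this
      · exact hvmin w ⟨hw, hwi⟩ (Finset.card_lt_card hlt)
    have proper : ∀ S : Set (Fin n), IsDilation A C S → S ⊆ supp v → S = supp v := by
      intro S hS hsub
      obtain ⟨w, hw0, hw, hwS⟩ := exists_ker_of_isDilation A C θ hS
      have hws : (supp w : Set (Fin n)) ⊆ S := fun j hj => by
        by_contra hjS
        exact (hsupp w j).1 hj (hwS j hjS)
      refine hsub.antisymm ?_
      by_contra hne
      exact hw0 (circuit w hw ⟨Finset.coe_subset.1 (hws.trans hsub),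
        fun h' => hne ((Finset.coe_subset.2 h').trans hws)⟩)
    refine h ⟨supp v, ⟨?_, fun S hS hd => hS.ne (proper S hd hS.subset)⟩, (hsupp v i).2 hvi⟩
    by_contra hnd
    have := hθ (supp v) (fun S hS hd => hnd (proper S hd hS ▸ hd)) v hv fun j hj => by
      by_contra hvj
      exact hj ((hsupp v j).2 hvj)
    exact hvi (congrFun this i)

end Dilation

/-! ### A determinant that does not vanish -/

/-- Minimum principle: at the index `m` of a negative minimum, the equation would give `u m ≥ u m /
2`. -/
theorem nonneg_of_eq_mul_add {ι : Type} [Fintype ι] {B : Matrix ι ι ℝ} {c u : ι → ℝ}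
    (hB : ∀ i j, 0 ≤ B i j) (hsum : ∀ j, ∑ i, B i j ≤ 1 / 2) (hc : ∀ j, 0 ≤ c j)
    (hu : ∀ j, u j = ∑ i, u i * B i j + c j) (j : ι) : 0 ≤ u j := by
  obtain ⟨m, -, hm⟩ := Finset.exists_min_image Finset.univ u ⟨j, Finset.mem_univ j⟩
  refine le_trans ?_ (hm j (Finset.mem_univ j))
  by_contra! hneg
  have h1 : ∑ i, u m * B i m ≤ ∑ i, u i * B i m :=
    Finset.sum_le_sum fun i _ => mul_le_mul_of_nonneg_right (hm i (Finset.mem_univ i)) (hB i m)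
  rw [← Finset.mul_sum] at h1
  have h2 := hu m
  have h3 := hc m
  have h4 := mul_le_mul_of_nonpos_left (hsum m) hneg.le
  linarith

/-- By Cramer's rule this determinant is `det (1 - B)` times the `i`-th entry of the solution of `u
= u B + c`, which is nonnegative, hence positive at `i` by `hpos`. -/
theorem det_updateRow_one_sub_ne_zero {ι : Type} [Fintype ι] [DecidableEq ι]
    {B : Matrix ι ι ℝ} {c : ι → ℝ} (i : ι)
    (hB : ∀ i j, 0 ≤ B i j) (hsum : ∀ j, ∑ i, B i j ≤ 1 / 2) (hc : ∀ j, 0 ≤ c j)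
    (hpos : ∀ u : ι → ℝ, (∀ j, 0 ≤ u j) → (∀ j, u j = ∑ i, u i * B i j + c j) → 0 < u i) :
    ((1 - B).updateRow i c).det ≠ 0 := by
  intro hdet
  obtain ⟨w, hw0, hw⟩ := Matrix.exists_vecMul_eq_zero_iff.2 hdet
  -- Moving the `i`-th term of the left null vector `w` to the other side makes `-w i` the
  -- coefficient of `c`; rescaling gives a solution that vanishes at `i`.
  let u : ι → ℝ := Function.update w i 0
  have hu : ∀ j, u j = ∑ l, u l * B l j + -w i * c j := by
    intro j
    have h := congrFun hw j
    rw [Matrix.vecMul, dotProduct, ← Finset.add_sum_erase _ _ (Finset.mem_univ i),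
      Matrix.updateRow_self] at h
    have h2 : ∑ l ∈ Finset.univ.erase i, w l * (1 - B).updateRow i c l j =
        ∑ l, u l * (1 - B) l j := by
      rw [← Finset.add_sum_erase _ (fun l => u l * (1 - B) l j) (Finset.mem_univ i)]
      simp only [u, Function.update_self, zero_mul, zero_add]
      refine Finset.sum_congr rfl fun l hl => ?_
      rw [Function.update_of_ne (Finset.ne_of_mem_erase hl),
        Matrix.updateRow_ne (Finset.ne_of_mem_erase hl)]
    have h3 : ∑ l, u l * (1 - B) l j = u j - ∑ l, u l * B l j := by
      simp [Matrix.sub_apply, mul_sub, Finset.sum_sub_distrib, Matrix.one_apply]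
    rw [h2, h3, Pi.zero_apply] at h
    linarith
  have hui : u i = 0 := by simp [u]
  by_cases hwi : w i = 0
  · refine hw0 (funext fun j => ?_)
    have hwu : u = w := by
      rw [← Function.update_eq_self i w, hwi]
    rw [hwu] at hu
    simp only [hwi, neg_zero, zero_mul] at hu
    have h1 := nonneg_of_eq_mul_add hB hsum (fun _ => le_rfl) hu j
    have h2 := nonneg_of_eq_mul_add (u := fun j => -w j) hB hsum (fun _ => le_rfl)
      (fun j => by simpa using congrArg Neg.neg (hu j)) j
    exact le_antisymm (neg_nonneg.1 h2) h1
  · have hu' : ∀ j, (-w i)⁻¹ * u j = ∑ l, (-w i)⁻¹ * u l * B l j + c j := by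
      intro j
      rw [hu j, mul_add, Finset.mul_sum, ← mul_assoc, inv_mul_cancel₀ (neg_ne_zero.2 hwi), one_mul]
      simp only [mul_assoc]
    have := hpos (fun j => (-w i)⁻¹ * u j) (nonneg_of_eq_mul_add hB hsum hc hu') hu'
    simp [hui] at this

/-! ### Common divisors of polynomials -/

open Polynomial in
/-- If the monic common divisors of an ideal of `R[X]` all divide `q`, then a multiple of `q` by a
nonzero constant lies in the ideal. -/
theorem exists_C_mul_mem_of_monic_dvd {R : Type} [CommRing R] [IsDomain R]
    [UniqueFactorizationMonoid R] (I : Ideal R[X]) {χ : R[X]} (hχ : χ.Monic) (hχI : χ ∈ I)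
    (q : R[X]) (H : ∀ h : R[X], h.Monic → (∀ g ∈ I, h ∣ g) → h ∣ q) :
    ∃ d : R, d ≠ 0 ∧ C d * q ∈ I := by
  let K := FractionRing R
  let φ : R[X] →+* K[X] := mapRingHom (algebraMap R K)
  obtain ⟨g, hg⟩ := (IsPrincipalIdealRing.principal (I.map φ)).principal
  rw [Ideal.submodule_span_eq] at hg
  have hdvd : ∀ f ∈ I, g ∣ φ f := fun f hf => by
    rw [← Ideal.mem_span_singleton, ← hg]
    exact Ideal.mem_map_of_mem φ hf
  have hg0 : g ≠ 0 := by
    rintro rfl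
    have := zero_dvd_iff.1 (hdvd χ hχI)
    exact (hχ.map (algebraMap R K)).ne_zero this
  -- Gauss: the generator over the fraction field divides a monic polynomial, so up to a constant it
  -- comes from a monic `h` over `R`.
  obtain ⟨h, hh⟩ := IsIntegrallyClosed.eq_map_mul_C_of_dvd K hχ (hdvd χ hχI)
  have hlc : g.leadingCoeff ≠ 0 := leadingCoeff_ne_zero.2 hg0
  have hhmap : h.map (algebraMap R K) = g * C g.leadingCoeff⁻¹ := by
    nth_rewrite 1 [← hh]
    rw [mul_assoc, ← C_mul, mul_inv_cancel₀ hlc, C_1, mul_one]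
  have hmonic : h.Monic := by
    apply Polynomial.monic_of_injective (IsFractionRing.injective R K)
    rw [hhmap]
    exact monic_mul_leadingCoeff_inv hg0
  have hassoc : h.map (algebraMap R K) ∣ g := ⟨C g.leadingCoeff, hh.symm⟩
  have hq : h ∣ q := H h hmonic fun f hf =>
    hmonic.isPrimitive.dvd_of_fraction_map_dvd_fraction_map (K := K) (hassoc.trans (hdvd f hf))
  have hqI : φ q ∈ I.map φ := by
    rw [hg, Ideal.mem_span_singleton]
    refine dvd_trans ⟨C g.leadingCoeff⁻¹, hhmap⟩ (map_dvd φ hq)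
  let : Algebra R[X] K[X] := φ.toAlgebra
  -- `K[X]` inverts the nonzero constants of `R[X]`, so membership descends after clearing a
  -- denominator `d`.
  have : IsLocalization ((nonZeroDivisors R).map (C : R →+* R[X])) K[X] :=
    Polynomial.isLocalization (nonZeroDivisors R) K
  obtain ⟨⟨⟨f, hf⟩, ⟨s, hs⟩⟩, hfs⟩ := (IsLocalization.mem_map_algebraMap_iff
    ((nonZeroDivisors R).map (C : R →+* R[X])) K[X]).1 hqI
  obtain ⟨d, hd, rfl⟩ := hs
  refine ⟨d, nonZeroDivisors.ne_zero hd, ?_⟩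
  have : φ (C d * q) = φ f := by
    rw [map_mul, mul_comm]
    exact hfs
  rwa [Polynomial.map_injective _ (IsFractionRing.injective R K) this]

/-- Over a domain the degree in `s` is additive, so a divisor of a nonzero polynomial free of `s` is
free of `s`. -/
theorem _root_.MvPolynomial.mem_supported_compl_of_dvd {σ : Type} {f g : MvPolynomial σ ℝ} {s : σ}
    (hfg : f ∣ g) (hg0 : g ≠ 0) (hg : g ∈ MvPolynomial.supported ℝ ({s}ᶜ : Set σ)) :
    f ∈ MvPolynomial.supported ℝ ({s}ᶜ : Set σ) := by
  classical
  have key : ∀ q : MvPolynomial σ ℝ, q ∈ MvPolynomial.supported ℝ ({s}ᶜ : Set σ) ↔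
      q.degreeOf s = 0 := by
    intro q
    rw [MvPolynomial.mem_supported, Set.subset_compl_singleton_iff, Finset.mem_coe,
      MvPolynomial.vars_def, Multiset.mem_toFinset, MvPolynomial.degreeOf_def,
      Multiset.count_eq_zero]
  rw [key] at hg ⊢
  obtain ⟨q, rfl⟩ := hfg
  rw [MvPolynomial.degreeOf_mul_eq (left_ne_zero_of_mul hg0) (right_ne_zero_of_mul hg0)] at hg
  omega

theorem det_mem_subalgebra {S ι : Type} [CommRing S] [Algebra ℝ S] [Fintype ι] [DecidableEq ι]
    (U : Subalgebra ℝ S) (M : Matrix ι ι S) (h : ∀ i j, M i j ∈ U) : M.det ∈ U := by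
  rw [Matrix.det_apply]
  refine sum_mem fun τ _ => ?_
  rw [Units.smul_def]
  exact zsmul_mem (prod_mem fun i _ => h _ _) _

/-! ### Nonzero modes of the output-reachable part -/

section Modes

open Polynomial

variable {n p : ℕ} (A : SMatrix (Fin n) (Fin n)) (C : SMatrix (Fin p) (Fin n))

/-- The joint parameters of `(A, C)`. -/
abbrev PairStars : Type := Stars A ⊕ Stars C

open Classical in
/-- The polynomial realization of `A`, with the rows of the states that are not output-reachable
replaced by zero. -/
def reachPoly : Matrix (Fin n) (Fin n) (MvPolynomial (PairStars A C) ℝ) :=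
  fun i j => if h : A i j = true ∧ OutputReachable A C i then
    MvPolynomial.X (Sum.inl ⟨(i, j), h.1⟩) else 0

/-- The polynomial realization of `C`. -/
def outPoly : Matrix (Fin p) (Fin n) (MvPolynomial (PairStars A C) ℝ) :=
  fun k j => if h : C k j = true then MvPolynomial.X (Sum.inr ⟨(k, j), h⟩) else 0

/-- The matrix `x - A` with its `i`-th row replaced by the `k`-th row of `C`. -/
def modeMatrix (k : Fin p) (i : Fin n) :
    Matrix (Fin n) (Fin n) (MvPolynomial (PairStars A C) ℝ)[X] :=
  (reachPoly A C).charmatrix.updateRow i fun j => Polynomial.C (outPoly A C k j)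

variable {A C} in
theorem OutputReachable.of_edge {i j : Fin n} (hj : OutputReachable A C j) (h : A j i = true) :
    OutputReachable A C i := by
  obtain ⟨k, hk⟩ := hj
  exact ⟨k, Relation.ReflTransGen.head (show (systemDigraph A C).Adj (Sum.inl i) (Sum.inl j) from h)
    hk⟩

/-- Evaluate at `x = 1` with small positive entries in `A` and ones in `C`: positivity of the
solution of `u = u B + c` spreads backwards along a path from `x_i` to `y_k`. -/
theorem modeMatrix_det_ne_zero {k : Fin p} {i : Fin n}
    (hik : Relation.ReflTransGen (systemDigraph A C).Adj (Sum.inl i) (Sum.inr k)) :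
    (modeMatrix A C k i).det ≠ 0 := by
  classical
  -- Small enough for each column of `B` to sum to at most `1 / 2`.
  let ε : ℝ := 1 / (2 * (n + 1))
  have hε : 0 < ε := by positivity
  let θ : PairStars A C → ℝ := Sum.elim (fun _ => ε) fun _ => 1
  let φ : (MvPolynomial (PairStars A C) ℝ)[X] →+* ℝ := eval₂RingHom (MvPolynomial.eval θ) 1
  let B : Matrix (Fin n) (Fin n) ℝ :=
    fun l m => if A l m = true ∧ OutputReachable A C l then ε else 0
  let c : Fin n → ℝ := fun m => if C k m = true then 1 else 0
  have hB : (reachPoly A C).map (MvPolynomial.eval θ) = B := by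
    ext l m
    by_cases h : A l m = true ∧ OutputReachable A C l <;> simp [reachPoly, B, h, θ]
  have hmap : (modeMatrix A C k i).map φ = (1 - B).updateRow i c := by
    ext l m
    rw [Matrix.map_apply, modeMatrix, Matrix.updateRow_apply, Matrix.updateRow_apply]
    split_ifs
    · by_cases h : C k m = true <;> simp [φ, outPoly, c, h, θ]
    · rw [← hB, Matrix.charmatrix_apply]
      by_cases h : l = m <;> simp [φ, h]
  have hB0 : ∀ l m, 0 ≤ B l m := fun l m => by
    simp only [B]
    split_ifs
    exacts [hε.le, le_rfl]
  have hBε : ∀ l m, B l m ≤ ε := fun l m => by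
    simp only [B]
    split_ifs
    exacts [le_rfl, hε.le]
  have hc0 : ∀ m, 0 ≤ c m := fun m => by
    simp only [c]
    split_ifs
    exacts [zero_le_one, le_rfl]
  intro h0
  have hdet := congrArg φ h0
  rw [RingHom.map_det, RingHom.mapMatrix_apply, hmap, map_zero] at hdet
  refine det_updateRow_one_sub_ne_zero i hB0 (fun m => ?_) hc0 ?_ hdet
  · refine (Finset.sum_le_sum fun l _ => hBε l m).trans ?_
    rw [Finset.sum_const, Finset.card_univ, Fintype.card_fin, nsmul_eq_mul, mul_one_div,
      div_le_div_iff₀ (by positivity) two_pos]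
    linarith
  · intro u hu0 hu
    have hle : ∀ l m, u l * B l m ≤ u m := fun l m => by
      rw [hu m]
      have : u l * B l m ≤ ∑ l, u l * B l m := Finset.single_le_sum
        (f := fun l => u l * B l m) (fun l _ => mul_nonneg (hu0 l) (hB0 l m)) (Finset.mem_univ l)
      have h2 := hc0 m
      linarith
    -- Outputs have no out-edges, so the only output vertex leading to `y_k` is `y_k` itself.
    suffices H : ∀ v, Relation.ReflTransGen (systemDigraph A C).Adj v (Sum.inr k) →
        Sum.elim (fun m => 0 < u m) (fun k' => k' = k) v from H _ hik
    intro v hv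
    induction hv using Relation.ReflTransGen.head_induction_on with
    | refl => rfl
    | @head v w hvw hwk ih =>
      match v, w with
      | Sum.inl m, Sum.inl l =>
        refine lt_of_lt_of_le ?_ (hle l m)
        have : B l m = ε := if_pos ⟨hvw, k, hwk⟩
        rw [this]
        exact mul_pos ih hε
      | Sum.inl m, Sum.inr k' =>
        obtain rfl : k' = k := ih
        have h1 : c m = 1 := if_pos hvw
        have h2 : 0 ≤ ∑ l, u l * B l m :=
          Finset.sum_nonneg fun l _ => mul_nonneg (hu0 l) (hB0 l m)
        simp only [Sum.elim_inl]
        rw [hu m, h1]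
        linarith
      | Sum.inr _, _ => exact hvw.elim

/-- Polynomials in `x` over the parameters as polynomials in all indeterminates. -/
abbrev flatten : (MvPolynomial (PairStars A C) ℝ)[X] ≃ₐ[ℝ]
    MvPolynomial (Option (PairStars A C)) ℝ :=
  (MvPolynomial.optionEquivLeft ℝ (PairStars A C)).symm

theorem flatten_reachPoly_mem {s : PairStars A C}
    {i : Fin n} (hs : ∀ j (h : A i j = true), OutputReachable A C i → s ≠ Sum.inl ⟨(i, j), h⟩)
    (j : Fin n) :
    flatten A C ((reachPoly A C).charmatrix i j) ∈
      MvPolynomial.supported ℝ ({some s}ᶜ : Set (Option (PairStars A C))) := by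
  have hX : flatten A C X ∈ MvPolynomial.supported ℝ ({some s}ᶜ : Set _) := by
    rw [MvPolynomial.optionEquivLeft_symm_X, MvPolynomial.X_mem_supported]
    simp
  have hA : flatten A C (Polynomial.C (reachPoly A C i j)) ∈
      MvPolynomial.supported ℝ ({some s}ᶜ : Set _) := by
    by_cases h : A i j = true ∧ OutputReachable A C i
    · rw [reachPoly, dif_pos h, MvPolynomial.optionEquivLeft_symm_C_X,
        MvPolynomial.X_mem_supported]
      simpa using (hs j h.1 h.2).symm
    · rw [reachPoly, dif_neg h, Polynomial.C_0, map_zero]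
      exact zero_mem _
  by_cases hij : i = j
  · subst hij
    rw [Matrix.charmatrix_apply_eq, map_sub]
    exact sub_mem hX hA
  · rw [Matrix.charmatrix_apply_ne _ _ _ hij, map_neg]
    exact neg_mem hA

theorem flatten_charpoly_mem {s : PairStars A C}
    (hs : ∀ i j (h : A i j = true), OutputReachable A C i → s ≠ Sum.inl ⟨(i, j), h⟩) :
    flatten A C (reachPoly A C).charpoly ∈
      MvPolynomial.supported ℝ ({some s}ᶜ : Set (Option (PairStars A C))) := by
  rw [Matrix.charpoly, AlgEquiv.map_det]
  exact det_mem_subalgebra _ _ fun i j => flatten_reachPoly_mem A C (hs i) j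

/-- The parameter at `(i, j)` occurs only in row `i`, which has been replaced. -/
theorem flatten_modeMatrix_det_mem (k : Fin p) (i j : Fin n) (h : A i j = true) :
    flatten A C (modeMatrix A C k i).det ∈ MvPolynomial.supported ℝ
      ({some (Sum.inl ⟨(i, j), h⟩)}ᶜ : Set (Option (PairStars A C))) := by
  rw [AlgEquiv.map_det]
  refine det_mem_subalgebra _ _ fun l m => ?_
  rw [AlgEquiv.mapMatrix_apply, Matrix.map_apply, modeMatrix, Matrix.updateRow_apply]
  split_ifs with hl
  · by_cases hc : C k m = true
    · rw [outPoly, dif_pos hc, MvPolynomial.optionEquivLeft_symm_C_X,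
        MvPolynomial.X_mem_supported]
      simp
    · rw [outPoly, dif_neg hc, Polynomial.C_0, map_zero]
      exact zero_mem _
  · refine flatten_reachPoly_mem A C (fun j' h' _ heq => hl ?_) m
    have := congrArg (fun s : Stars A => s.1.1) (Sum.inl_injective heq)
    exact this.symm

theorem dvd_X_pow_of_common_divisor {h : (MvPolynomial (PairStars A C) ℝ)[X]}
    (hχ : h ∣ (reachPoly A C).charpoly) (hdet : ∀ k i, h ∣ (modeMatrix A C k i).det) :
    h ∣ X ^ n := by
  have hmem : flatten A C h ∈
      MvPolynomial.supported ℝ ({none} : Set (Option (PairStars A C))) := by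
    have hall : ∀ s : PairStars A C, flatten A C h ∈
        MvPolynomial.supported ℝ ({some s}ᶜ : Set (Option (PairStars A C))) := by
      intro s
      -- A parameter outside the reachable rows of `A` is absent from the characteristic polynomial;
      -- one in a reachable row `i` is absent from a nonzero determinant for `i`.
      by_cases hs : ∀ i j (h : A i j = true), OutputReachable A C i → s ≠ Sum.inl ⟨(i, j), h⟩
      · refine MvPolynomial.mem_supported_compl_of_dvd (map_dvd (flatten A C) hχ) ?_
          (flatten_charpoly_mem A C hs)
        rw [Ne, EmbeddingLike.map_eq_zero_iff]
        exact (Matrix.charpoly_monic _).ne_zero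
      · push Not at hs
        obtain ⟨i, j, hij, ⟨k, hk⟩, rfl⟩ := hs
        refine MvPolynomial.mem_supported_compl_of_dvd (map_dvd (flatten A C) (hdet k i)) ?_
          (flatten_modeMatrix_det_mem A C k i j hij)
        rw [Ne, EmbeddingLike.map_eq_zero_iff]
        exact modeMatrix_det_ne_zero A C hk
    rw [MvPolynomial.mem_supported]
    intro s hs
    cases s with
    | none => rfl
    | some s => exact absurd rfl ((MvPolynomial.mem_supported.1 (hall s)) hs)
  -- Setting all parameters to zero fixes the parameter-free `h` and turns the characteristic
  -- polynomial into `X ^ n`.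
  let Z : MvPolynomial (PairStars A C) ℝ →+* MvPolynomial (PairStars A C) ℝ :=
    MvPolynomial.C.comp (MvPolynomial.eval 0)
  have hfix : ∀ f : MvPolynomial (Option (PairStars A C)) ℝ,
      f ∈ MvPolynomial.supported ℝ ({none} : Set (Option (PairStars A C))) →
      ((flatten A C).symm f).map Z = (flatten A C).symm f := by
    intro f hf
    refine Algebra.adjoin_induction (fun g hg => ?_) (fun r => ?_) (fun g g' _ _ hg hg' => ?_)
      (fun g g' _ _ hg hg' => ?_) hf
    · obtain ⟨_, rfl, rfl⟩ := hg
      simp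
    · simp [MvPolynomial.algebraMap_eq, Z]
    · rw [map_add, Polynomial.map_add, hg, hg']
    · rw [map_mul, Polynomial.map_mul, hg, hg']
  have h1 : h.map Z = h := by simpa using hfix _ hmem
  have h2 : (reachPoly A C).map Z = 0 := by
    ext1 i j
    by_cases h : A i j = true ∧ OutputReachable A C i <;> simp [reachPoly, h, Z]
  have h3 := map_dvd (mapRingHom Z) hχ
  rw [coe_mapRingHom, h1, ← Matrix.charpoly_map, h2, Matrix.charpoly_zero, Fintype.card_fin] at h3
  exact h3

/-- Generically, an eigenvector to a nonzero eigenvalue that is invisible in the output vanishes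
at all output-reachable states. -/
theorem generic_eigenvector_eq_zero_of_outputReachable :
    Generic fun θ : PairStars A C → ℝ => ∀ (μ : ℂ) (u : Fin n → ℂ), μ ≠ 0 →
      ((realize A fun s => θ (Sum.inl s)).map Complex.ofReal).mulVec u = μ • u →
      ((realize C fun s => θ (Sum.inr s)).map Complex.ofReal).mulVec u = 0 →
      ∀ i, OutputReachable A C i → u i = 0 := by
  classical
  let I : Ideal (MvPolynomial (PairStars A C) ℝ)[X] := Ideal.span
    (insert (reachPoly A C).charpoly
      (Set.range fun ki : Fin p × Fin n => (modeMatrix A C ki.1 ki.2).det))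
  have hχI : (reachPoly A C).charpoly ∈ I := Ideal.subset_span (Set.mem_insert _ _)
  have hgI : ∀ k i, (modeMatrix A C k i).det ∈ I := fun k i =>
    Ideal.subset_span (Set.mem_insert_of_mem _ ⟨(k, i), rfl⟩)
  obtain ⟨d, hd, hdI⟩ := exists_C_mul_mem_of_monic_dvd I (Matrix.charpoly_monic _) hχI (X ^ n)
    fun h _ hh => dvd_X_pow_of_common_divisor A C (hh _ hχI) fun k i => hh _ (hgI k i)
  refine ⟨d, hd, fun θ hθ μ u hμ hu hCu i hi => ?_⟩
  let φ : (MvPolynomial (PairStars A C) ℝ)[X] →+* ℂ :=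
    eval₂RingHom (Complex.ofRealHom.comp (MvPolynomial.eval θ)) μ
  -- A reachable row of `A` has free entries only in reachable columns, so truncating `u` leaves an
  -- eigenvector of the reduced matrix, still invisible to `C`.
  let v : Fin n → ℂ := fun j => if OutputReachable A C j then u j else 0
  by_contra hui
  have hv0 : v ≠ 0 := fun h => hui (by simpa [v, hi] using congrFun h i)
  have hrow : ∀ l, ∑ j, φ ((reachPoly A C).charmatrix l j) * v j = 0 := by
    intro l
    have hentry : ∀ j, φ ((reachPoly A C).charmatrix l j) * v j =
        (if l = j then μ * v j else 0) -
          if OutputReachable A C l then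
            (realize A (fun s => θ (Sum.inl s)) l j : ℂ) * u j else 0 := by
      intro j
      rw [Matrix.charmatrix_apply, map_sub, sub_mul]
      congr 1
      · by_cases h : l = j <;> simp [h, φ]
      · by_cases hl : OutputReachable A C l
        · by_cases hA : A l j = true
          · have hj : OutputReachable A C j := hl.of_edge hA
            simp [φ, reachPoly, hA, hl, hj, v, realize]
          · simp [φ, reachPoly, hA, realize]
        · simp [φ, reachPoly, hl]
    simp only [hentry, Finset.sum_sub_distrib, Finset.sum_ite_eq, Finset.mem_univ, if_true]
    by_cases hl : OutputReachable A C l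
    · have := congrFun hu l
      rw [Matrix.mulVec, dotProduct] at this
      simp only [Matrix.map_apply, Pi.smul_apply, smul_eq_mul] at this
      simp only [hl, if_true, v, this, sub_self]
    · simp [hl, v]
  have hout : ∀ k, ∑ j, φ (Polynomial.C (outPoly A C k j)) * v j = 0 := by
    intro k
    rw [← Pi.zero_apply (M := fun _ => ℂ) k, ← hCu, Matrix.mulVec, dotProduct]
    refine Finset.sum_congr rfl fun j _ => ?_
    by_cases hC : C k j = true
    · have hj : OutputReachable A C j := ⟨k, Relation.ReflTransGen.single hC⟩
      simp [φ, outPoly, hC, hj, v, realize]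
    · simp [φ, outPoly, hC, realize]
  -- At `x = μ`, the vector `v` is in the kernel of every matrix whose determinant generates `I`;
  -- hence `d(θ) * μ ^ n = 0`.
  have hker : I ≤ RingHom.ker φ := by
    refine Ideal.span_le.2 ?_
    rintro _ (rfl | ⟨⟨k, l⟩, rfl⟩)
    · rw [SetLike.mem_coe, RingHom.mem_ker, Matrix.charpoly, RingHom.map_det]
      exact Matrix.exists_mulVec_eq_zero_iff.1 ⟨v, hv0, funext hrow⟩
    · rw [SetLike.mem_coe, RingHom.mem_ker, RingHom.map_det]
      refine Matrix.exists_mulVec_eq_zero_iff.1 ⟨v, hv0, funext fun m => ?_⟩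
      rw [Matrix.mulVec, dotProduct]
      simp only [RingHom.mapMatrix_apply, Matrix.map_apply, modeMatrix]
      by_cases hm : m = l
      · subst hm
        simpa only [Pi.zero_apply, Matrix.updateRow_self] using hout k
      · simpa only [Pi.zero_apply, Matrix.updateRow_ne hm] using hrow m
  have h0 := RingHom.mem_ker.1 (hker hdI)
  rw [map_mul, map_pow] at h0
  simp [φ, hμ, hθ] at h0

end Modes

/-! ### Functional observability and the unobservable subspace -/

/-- The vector `v` lies in the unobservable subspace of `(A, C)`. -/
def Unobservable {R : Type} [CommRing R] {n p : ℕ} (A : Matrix (Fin n) (Fin n) R)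
    (C : Matrix (Fin p) (Fin n) R) (v : Fin n → R) : Prop :=
  ∀ k : ℕ, (C * A ^ k).mulVec v = 0

section System

variable {n p r : ℕ} {A : Matrix (Fin n) (Fin n) ℝ} {C : Matrix (Fin p) (Fin n) ℝ}
  {F : Matrix (Fin r) (Fin n) ℝ}

/-- Differentiate `L e = 0` on the open interval; continuity adds the endpoints. -/
theorem mulVec_mul_eq_zero_of_integral_eq {m : ℕ} (L : Matrix (Fin m) (Fin n) ℝ)
    {e : ℝ → Fin n → ℝ} (he : Continuous e) {e₀ : Fin n → ℝ}
    (hint : ∀ t, 0 ≤ t → e t = e₀ + ∫ s in (0 : ℝ)..t, A.mulVec (e s))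
    (hL : ∀ t ∈ Set.Icc (0 : ℝ) 1, L.mulVec (e t) = 0) :
    ∀ t ∈ Set.Icc (0 : ℝ) 1, (L * A).mulVec (e t) = 0 := by
  let a : (Fin n → ℝ) →L[ℝ] (Fin n → ℝ) := A.mulVecLin.toContinuousLinearMap
  let l : (Fin n → ℝ) →L[ℝ] (Fin m → ℝ) := L.mulVecLin.toContinuousLinearMap
  have hae : Continuous fun s => a (e s) := a.continuous.comp he
  have hopen : Set.EqOn (fun t => l (a (e t))) (fun _ => 0) (Set.Ioo (0 : ℝ) 1) := by
    intro t ht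
    have h1 : HasDerivAt (fun t => e₀ + ∫ s in (0 : ℝ)..t, a (e s)) (a (e t)) t :=
      ((hae.integral_hasStrictDerivAt 0 t).hasDerivAt).const_add e₀
    have h2 := l.hasFDerivAt.comp_hasDerivAt t h1
    have h3 : (l ∘ fun t => e₀ + ∫ s in (0 : ℝ)..t, a (e s)) =ᶠ[nhds t] fun _ => 0 := by
      filter_upwards [Ioo_mem_nhds ht.1 ht.2] with s hs
      have := hL s ⟨hs.1.le, hs.2.le⟩
      rw [hint s hs.1.le] at this
      exact this
    exact (h2.congr_of_eventuallyEq h3.symm).unique (hasDerivAt_const t 0)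
  have hclosed := hopen.closure (l.continuous.comp hae) continuous_const
  rw [closure_Ioo zero_ne_one] at hclosed
  intro t ht
  rw [← Matrix.mulVec_mulVec]
  exact hclosed ht

/-- The difference of two trajectories solves the homogeneous equation, whatever the input. Equal
outputs make it unobservable at time 0, and `T = 1` always suffices. -/
theorem functionallyObservable_of_unobservable
    (h : ∀ v, Unobservable A C v → F.mulVec v = 0) : FunctionallyObservable A C F := by
  intro m B x₀ u hu
  refine ⟨1, one_pos, fun x₁ x x' hx hx' hy => ?_⟩
  let a : (Fin n → ℝ) →L[ℝ] (Fin n → ℝ) := A.mulVecLin.toContinuousLinearMap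
  let b : (Fin m → ℝ) →L[ℝ] (Fin n → ℝ) := B.mulVecLin.toContinuousLinearMap
  have integrable : ∀ z : ℝ → Fin n → ℝ, ContinuousOn z (Set.Ici 0) → ∀ t, 0 ≤ t →
      IntervalIntegrable (fun s => A.mulVec (z s) + B.mulVec (u s)) volume 0 t := by
    intro z hz t ht
    refine IntervalIntegrable.add (ContinuousOn.intervalIntegrable ?_) ?_
    · refine a.continuous.comp_continuousOn (hz.mono ?_)
      rw [Set.uIcc_of_le ht]
      exact Set.Icc_subset_Ici_self
    · exact ⟨b.integrable_comp (hu t ht).1, b.integrable_comp (hu t ht).2⟩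
  -- Freezing negative times at 0 makes the difference continuous on all of `ℝ`.
  let e : ℝ → Fin n → ℝ := fun t => x (max t 0) - x' (max t 0)
  have hmax : Continuous fun t : ℝ => max t 0 := continuous_id.max continuous_const
  have he : Continuous e :=
    (hx.1.comp_continuous hmax fun t => le_max_right t 0).sub
      (hx'.1.comp_continuous hmax fun t => le_max_right t 0)
  have het : ∀ t, 0 ≤ t → e t = x t - x' t := fun t ht => by simp only [e, max_eq_left ht]
  have hint : ∀ t, 0 ≤ t → e t = (x₀ - x₁) + ∫ s in (0 : ℝ)..t, A.mulVec (e s) := by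
    intro t ht
    have hcongr : ∫ s in (0 : ℝ)..t, A.mulVec (e s) =
        ∫ s in (0 : ℝ)..t, ((A.mulVec (x s) + B.mulVec (u s)) -
          (A.mulVec (x' s) + B.mulVec (u s))) := by
      refine intervalIntegral.integral_congr fun s hs => ?_
      rw [Set.uIcc_of_le ht] at hs
      rw [het s hs.1, Matrix.mulVec_sub]
      abel
    rw [hcongr, intervalIntegral.integral_sub (integrable x hx.1 t ht) (integrable x' hx'.1 t ht),
      het t ht, hx.2 t ht, hx'.2 t ht]
    abel
  have hzero : ∀ k : ℕ, ∀ t ∈ Set.Icc (0 : ℝ) 1, (C * A ^ k).mulVec (e t) = 0 := by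
    intro k
    induction k with
    | zero =>
      intro t ht
      rw [pow_zero, Matrix.mul_one, het t ht.1, Matrix.mulVec_sub, hy t ht, sub_self]
    | succ k ih =>
      rw [pow_succ, ← Matrix.mul_assoc]
      exact mulVec_mul_eq_zero_of_integral_eq _ he hint ih
  have h0 : e 0 = x₀ - x₁ := by
    rw [hint 0 le_rfl, intervalIntegral.integral_same, add_zero]
  have := h (x₀ - x₁) fun k => by
    rw [← h0]
    exact hzero k 0 ⟨le_rfl, zero_le_one⟩
  rwa [Matrix.mulVec_sub, sub_eq_zero] at this

/-- With zero input, the trajectories from 0 and from `v` both have zero output for all time, so no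
finite `T` separates them. -/
theorem FunctionallyObservable.mulVec_eq_zero (h : FunctionallyObservable A C F)
    {v : Fin n → ℝ} (hv : Unobservable A C v) : F.mulVec v = 0 := by
  let a : (Fin n → ℝ) →L[ℝ] (Fin n → ℝ) := A.mulVecLin.toContinuousLinearMap
  let c : (Fin n → ℝ) →L[ℝ] (Fin p → ℝ) := C.mulVecLin.toContinuousLinearMap
  let z : ℝ → Fin n → ℝ := fun t => NormedSpace.exp (t • a) v
  have hz : ∀ t, HasDerivAt z (a (z t)) t := fun t => by
    have h1 := (hasDerivAt_exp_smul_const' (𝕂 := ℝ) a t).clm_apply (hasDerivAt_const t v)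
    simpa [z] using h1
  have hzc : Continuous z := continuous_iff_continuousAt.2 fun t => (hz t).continuousAt
  have hz0 : z 0 = v := by simp [z]
  have ha : ∀ k : ℕ, (a ^ k) v = (A ^ k).mulVec v := by
    intro k
    induction k with
    | zero => simp
    | succ k ih =>
      rw [pow_succ', mul_apply_eq_comp, ih, pow_succ', ← Matrix.mulVec_mulVec]
      rfl
  have hcz : ∀ t, C.mulVec (z t) = 0 := by
    intro t
    have h1 := NormedSpace.exp_series_hasSum_exp' (𝕂 := ℝ) (t • a)
    have h2 := (h1.mapL (ContinuousLinearMap.apply ℝ (Fin n → ℝ) v)).mapL c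
    refine h2.unique ?_
    convert hasSum_zero using 2 with k
    simp only [smul_pow, ContinuousLinearMap.apply_apply,
      map_smul, ha]
    have : c ((A ^ k).mulVec v) = 0 := by
      have := hv k
      rwa [← Matrix.mulVec_mulVec] at this
    rw [this, smul_zero, smul_zero]
  obtain ⟨T, -, hT⟩ := h 0 0 0 0 fun t _ => intervalIntegrable_const
  have := hT v (fun _ => 0) z ⟨continuousOn_const, fun t _ => by simp⟩
    ⟨hzc.continuousOn, fun t _ => ?_⟩ fun t _ => by rw [hcz, Matrix.mulVec_zero]
  · rw [← this, Matrix.mulVec_zero]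
  · have h1 := intervalIntegral.integral_eq_sub_of_hasDerivAt (a := 0) (b := t)
      (fun s _ => hz s) ((a.continuous.comp hzc).intervalIntegrable 0 t)
    rw [hz0] at h1
    have h2 : ∫ s in (0 : ℝ)..t, (A.mulVec (z s) +
        (0 : Matrix (Fin n) (Fin 0) ℝ).mulVec ((0 : ℝ → Fin 0 → ℝ) s)) = z t - v := by
      rw [← h1]
      refine intervalIntegral.integral_congr fun s _ => ?_
      simp [a]
    rw [h2]
    abel

end System

/-! ### Diagonalizable systems -/

theorem IsDiagonalizable.iSup_eigenspace_eq_top {n : ℕ} {A : Matrix (Fin n) (Fin n) ℝ}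
    (hA : IsDiagonalizable A) :
    ⨆ μ : ℂ, Module.End.genEigenspace (A.map Complex.ofReal).mulVecLin μ 1 = ⊤ := by
  obtain ⟨P, d, hP, hPd⟩ := hA
  rw [eq_top_iff]
  intro v _
  have hv : v = ∑ j, (P⁻¹.mulVec v) j • P.col j := by
    have h1 : P.mulVec (P⁻¹.mulVec v) = v := by
      rw [Matrix.mulVec_mulVec, Matrix.mul_nonsing_inv _ ((Matrix.isUnit_iff_isUnit_det _).1 hP),
        Matrix.one_mulVec]
    nth_rewrite 1 [← h1]
    ext i
    simp [Matrix.mulVec, dotProduct, mul_comm]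
  rw [hv]
  refine sum_mem fun j _ => Submodule.smul_mem _ _ (Submodule.mem_iSup_of_mem (d j) ?_)
  rw [Module.End.mem_genEigenspace_one, Matrix.mulVecLin_apply]
  ext i
  have := congrFun (congrFun hPd i) j
  rw [Matrix.mul_diagonal] at this
  rw [Pi.smul_apply, smul_eq_mul, mul_comm]
  exact this

theorem map_ofReal_mulVec {ι κ : Type} [Fintype κ] (B : Matrix ι κ ℝ) (v : κ → ℝ) :
    (B.map Complex.ofReal).mulVec (fun j => (v j : ℂ)) = fun i => ((B.mulVec v i : ℝ) : ℂ) := by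
  ext i
  simp [Matrix.mulVec, dotProduct]

theorem mulVec_re_im_eq_zero {ι κ : Type} [Fintype κ] {B : Matrix ι κ ℝ} {u : κ → ℂ}
    (h : (B.map Complex.ofReal).mulVec u = 0) :
    B.mulVec (fun j => (u j).re) = 0 ∧ B.mulVec (fun j => (u j).im) = 0 := by
  constructor
  · ext i
    simpa [Matrix.mulVec, dotProduct] using congrArg Complex.re (congrFun h i)
  · ext i
    simpa [Matrix.mulVec, dotProduct] using congrArg Complex.im (congrFun h i)

/-- For diagonalizable `A`, unobservable vectors vanish at `i` if unobservable eigenvectors do. -/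
theorem Unobservable.apply_eq_zero {n p : ℕ} {A : Matrix (Fin n) (Fin n) ℝ}
    {C : Matrix (Fin p) (Fin n) ℝ} (hA : IsDiagonalizable A) {i : Fin n}
    (h0 : ∀ v : Fin n → ℝ, A.mulVec v = 0 → C.mulVec v = 0 → v i = 0)
    (h1 : ∀ (μ : ℂ) (u : Fin n → ℂ), μ ≠ 0 → (A.map Complex.ofReal).mulVec u = μ • u →
      (C.map Complex.ofReal).mulVec u = 0 → u i = 0)
    {v : Fin n → ℝ} (hv : Unobservable A C v) : v i = 0 := by
  let A' := A.map Complex.ofReal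
  let C' := C.map Complex.ofReal
  let N : Submodule ℂ (Fin n → ℂ) := ⨅ k : ℕ, LinearMap.ker (C' * A' ^ k).mulVecLin
  have hmem : ∀ w, w ∈ N ↔ Unobservable A' C' w := fun w => by
    simp [N, Submodule.mem_iInf, Unobservable]
  have hinv : ∀ w ∈ N, A'.mulVecLin w ∈ N := by
    intro w hw
    rw [hmem] at hw ⊢
    intro k
    rw [Matrix.mulVecLin_apply, Matrix.mulVec_mulVec, Matrix.mul_assoc, ← pow_succ]
    exact hw (k + 1)
  have hle : N ≤ LinearMap.ker (LinearMap.proj i : (Fin n → ℂ) →ₗ[ℂ] ℂ) := by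
    -- An invariant subspace of a diagonalizable map is the sum of its intersections with the
    -- eigenspaces.
    have h := Submodule.inf_iSup_genEigenspace hinv 1
    rw [hA.iSup_eigenspace_eq_top, inf_top_eq] at h
    rw [h]
    refine iSup_le fun μ u hu => ?_
    obtain ⟨huN, hu⟩ := Submodule.mem_inf.1 hu
    rw [Module.End.mem_genEigenspace_one, Matrix.mulVecLin_apply] at hu
    have hCu : C'.mulVec u = 0 := by
      have := (hmem u).1 huN 0
      rwa [pow_zero, Matrix.mul_one] at this
    rw [LinearMap.mem_ker, LinearMap.proj_apply]
    by_cases hμ : μ = 0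
    · rw [hμ, zero_smul] at hu
      obtain ⟨hre, him⟩ := mulVec_re_im_eq_zero hu
      obtain ⟨hre', him'⟩ := mulVec_re_im_eq_zero hCu
      exact Complex.ext (h0 _ hre hre') (h0 _ him him')
    · exact h1 μ u hμ hu hCu
  have hvN : (fun j => (v j : ℂ)) ∈ N := by
    rw [hmem]
    intro k
    have hmap : C' * A' ^ k = (C * A ^ k).map Complex.ofReal := by
      change C.map Complex.ofRealHom * A.map Complex.ofRealHom ^ k =
        (C * A ^ k).map Complex.ofRealHom
      rw [Matrix.map_mul, Matrix.map_pow]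
    rw [hmap, map_ofReal_mulVec, hv k]
    ext
    simp
  simpa using hle hvN

/-! ### Structural functional observability -/

section Main

variable {n p r : ℕ} (A : SMatrix (Fin n) (Fin n)) (C : SMatrix (Fin p) (Fin n))
  (F : SMatrix (Fin r) (Fin n))

theorem sFO_iff_generic : SFO A C F ↔ Generic fun θ : Stars A ⊕ Stars C ⊕ Stars F → ℝ =>
    FunctionallyObservable
      (realize A fun s => θ (Sum.inl s))
      (realize C fun s => θ (Sum.inr (Sum.inl s)))
      (realize F fun s => θ (Sum.inr (Sum.inr s))) :=
  exists_properVariety_iff_generic _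

/-- The parameters of `[A; C]` among those of `(A, C)`. -/
def pairOfStack : Stars (stack A C) → PairStars A C
  | ⟨(Sum.inl i, j), h⟩ => Sum.inl ⟨(i, j), h⟩
  | ⟨(Sum.inr k, j), h⟩ => Sum.inr ⟨(k, j), h⟩

theorem pairOfStack_injective : Function.Injective (pairOfStack A C) := by
  rintro ⟨⟨i | i, j⟩, h⟩ ⟨⟨i' | i', j'⟩, h'⟩ heq
  · have := congrArg Subtype.val (Sum.inl_injective heq)
    exact Subtype.ext (Prod.ext (congrArg Sum.inl (congrArg Prod.fst this))
      (congrArg Prod.snd this :))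
  · cases heq
  · cases heq
  · have := congrArg Subtype.val (Sum.inr_injective heq)
    exact Subtype.ext (Prod.ext (congrArg Sum.inr (congrArg Prod.fst this))
      (congrArg Prod.snd this :))

theorem realize_pairOfStack (θ : PairStars A C → ℝ) :
    (realize (stack A C) fun s => θ (pairOfStack A C s)) =
      Matrix.fromRows (realize A fun s => θ (Sum.inl s)) (realize C fun s => θ (Sum.inr s)) := by
  ext (i | i) j <;> rfl

/-- The parameters of `[A; C; F]` among those of `(A, C, F)`. -/
def tripleOfStack (s : Stars (stack (stack A C) F)) : Stars A ⊕ Stars C ⊕ Stars F :=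
  match s with
  | ⟨(Sum.inl (Sum.inl i), j), h⟩ => Sum.inl ⟨(i, j), h⟩
  | ⟨(Sum.inl (Sum.inr k), j), h⟩ => Sum.inr (Sum.inl ⟨(k, j), h⟩)
  | ⟨(Sum.inr k, j), h⟩ => Sum.inr (Sum.inr ⟨(k, j), h⟩)

theorem tripleOfStack_injective : Function.Injective (tripleOfStack A C F) := by
  rintro ⟨⟨(i | i) | i, j⟩, h⟩ ⟨⟨(i' | i') | i', j'⟩, h'⟩ heq <;> simp [tripleOfStack] at heq
  all_goals
    obtain ⟨rfl, rfl⟩ := heq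
    rfl

theorem realize_tripleOfStack (θ : Stars A ⊕ Stars C ⊕ Stars F → ℝ) :
    (realize (stack (stack A C) F) fun s => θ (tripleOfStack A C F s)) =
      Matrix.fromRows
        (Matrix.fromRows (realize A fun s => θ (Sum.inl s))
          (realize C fun s => θ (Sum.inr (Sum.inl s))))
        (realize F fun s => θ (Sum.inr (Sum.inr s))) := by
  ext ((i | i) | i) j <;> rfl

theorem unobservable_of_mulVec_eq_zero {A : Matrix (Fin n) (Fin n) ℝ} {C : Matrix (Fin p) (Fin n) ℝ}
    {v : Fin n → ℝ} (hA : A.mulVec v = 0) (hC : C.mulVec v = 0) : Unobservable A C v := by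
  intro k
  cases k with
  | zero => rwa [pow_zero, Matrix.mul_one]
  | succ k =>
    rw [pow_succ, ← Matrix.mul_assoc, ← Matrix.mulVec_mulVec, hA, Matrix.mulVec_zero]

theorem fromRows_mulVec_eq_zero_iff {ι₁ ι₂ κ : Type} [Fintype κ] {M : Matrix ι₁ κ ℝ}
    {N : Matrix ι₂ κ ℝ} {v : κ → ℝ} :
    (Matrix.fromRows M N).mulVec v = 0 ↔ M.mulVec v = 0 ∧ N.mulVec v = 0 := by
  have h := SetLike.ext_iff.1 (ker_fromRows M N) v
  simpa using h

variable {A C F}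

/-- The kernel of `[A; C]` is unobservable, so at a functionally observable point `F` kills it;
choose such a point where `[A; C; F]` attains its generic rank. -/
theorem SFO.grank_eq (h : SFO A C F) : grank (stack A C) = grank (stack (stack A C) F) := by
  rw [sFO_iff_generic] at h
  obtain ⟨θ, hFO, hrank⟩ := (h.and ((generic_grank (stack (stack A C) F)).comp_injective
    (tripleOfStack_injective A C F))).exists_point
  refine le_antisymm (grank_le_grank_stack _ _) ?_
  rw [← hrank, realize_tripleOfStack]
  refine ((ker_le_ker_iff_rank _ _).1 fun v hv => ?_).symm.le.trans ?_
  · rw [LinearMap.mem_ker, Matrix.mulVecLin_apply, fromRows_mulVec_eq_zero_iff] at hv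
    exact hFO.mulVec_eq_zero (unobservable_of_mulVec_eq_zero hv.1 hv.2)
  · rw [← realize_stackParam]
    exact rank_realize_le _ _

/-- Vectors vanishing at all output-reachable states form an `A`-invariant subspace that `C`
annihilates. -/
theorem unobservable_single_of_not_outputReachable {i : Fin n} (hi : ¬ OutputReachable A C i)
    (θ : Stars A → ℝ) (η : Stars C → ℝ) :
    Unobservable (realize A θ) (realize C η) (Pi.single i 1) := by
  have hpow : ∀ k : ℕ, ∀ j, OutputReachable A C j →
      ((realize A θ ^ k).mulVec (Pi.single i 1)) j = 0 := by
    intro k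
    induction k with
    | zero =>
      intro j hj
      rw [pow_zero, Matrix.one_mulVec]
      refine Pi.single_eq_of_ne ?_ _
      rintro rfl
      exact hi hj
    | succ k ih =>
      intro j hj
      rw [pow_succ', ← Matrix.mulVec_mulVec, Matrix.mulVec, dotProduct]
      refine Finset.sum_eq_zero fun l _ => ?_
      by_cases hl : A j l = true
      · rw [ih l (hj.of_edge hl), mul_zero]
      · rw [realize, dif_neg hl, zero_mul]
  intro k
  rw [← Matrix.mulVec_mulVec]
  ext m
  rw [Matrix.mulVec, dotProduct]
  refine Finset.sum_eq_zero fun l _ => ?_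
  by_cases hl : C m l = true
  · rw [hpow k l ⟨m, Relation.ReflTransGen.single hl⟩, mul_zero]
  · rw [realize, dif_neg hl, zero_mul]

theorem SFO.outputReachable (h : SFO A C F) {i : Fin n} (hi : i ∈ functionalStates F) :
    OutputReachable A C i := by
  by_contra hreach
  obtain ⟨k, hk⟩ := hi
  rw [sFO_iff_generic] at h
  have hX : Generic fun θ : Stars A ⊕ Stars C ⊕ Stars F → ℝ =>
      θ (Sum.inr (Sum.inr ⟨(k, i), hk⟩)) ≠ 0 :=
    ⟨MvPolynomial.X _, MvPolynomial.X_ne_zero _, fun θ hθ => by rwa [MvPolynomial.eval_X] at hθ⟩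
  obtain ⟨θ, hFO, hθ⟩ := (h.and hX).exists_point
  have := congrFun (hFO.mulVec_eq_zero
    (unobservable_single_of_not_outputReachable hreach _ _)) k
  rw [Matrix.mulVec_single_one] at this
  simp [realize, hk] at this
  exact hθ this

/-- The rank condition handles eigenvalue 0 and reachability the nonzero ones; diagonalizability
ensures that eigenvectors suffice. -/
theorem sFO_of_outputReachable_of_grank_eq (hA : GenericallyDiagonalizable A)
    (hreach : ∀ i ∈ functionalStates F, OutputReachable A C i)
    (hrank : grank (stack A C) = grank (stack (stack A C) F)) : SFO A C F := by
  rw [sFO_iff_generic]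
  have hdiag : Generic fun θ : Stars A → ℝ => IsDiagonalizable (realize A θ) :=
    (exists_properVariety_iff_generic _).1 hA
  have hker := ((grank_eq_grank_stack_iff_vanish _ _).1 hrank).comp_injective
    (pairOfStack_injective A C)
  have hpair := hker.and (generic_eigenvector_eq_zero_of_outputReachable A C)
  have e1 : Function.Injective (Sum.inl : Stars A → Stars A ⊕ Stars C ⊕ Stars F) :=
    Sum.inl_injective
  have e2 : Function.Injective
      (Sum.map id Sum.inl : PairStars A C → Stars A ⊕ Stars C ⊕ Stars F) :=
    Sum.map_injective.2 ⟨Function.injective_id, Sum.inl_injective⟩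
  refine ((hdiag.comp_injective e1).and (hpair.comp_injective e2)).mono ?_
  rintro θ ⟨hd, hk, hm⟩
  rw [realize_pairOfStack A C fun s => θ (Sum.map id Sum.inl s)] at hk
  refine functionallyObservable_of_unobservable fun v hv => ?_
  ext k
  rw [Matrix.mulVec, dotProduct]
  refine Finset.sum_eq_zero fun i _ => ?_
  by_cases hF : F k i = true
  · have hi : i ∈ functionalStates F := ⟨k, hF⟩
    rw [hv.apply_eq_zero hd (fun w hw hw' => hk w (fromRows_mulVec_eq_zero_iff.2 ⟨hw, hw'⟩) i hi)
      (fun μ u hμ hu hu' => hm μ u hμ hu hu' i (hreach i hi)), mul_zero]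
  · rw [realize, dif_neg hF, zero_mul]

theorem grank_unitRow_iff (i : Fin n) :
    grank (stack A C) = grank (stack (stack A C) (unitRow i)) ↔
      ¬ ∃ S : Set (Fin n), IsMinimalDilation A C S ∧ i ∈ S := by
  rw [grank_eq_grank_stack_iff_vanish, functionalStates_unitRow,
    ← ker_vanish_iff_no_minimalDilation]
  simp only [Set.mem_singleton_iff, forall_eq]

end Main

end StructSys

end

theorem mainTheorem2 {n p r : ℕ} (A : StructSys.SMatrix (Fin n) (Fin n))
    (C : StructSys.SMatrix (Fin p) (Fin n)) (F : StructSys.SMatrix (Fin r) (Fin n))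
    (hA : StructSys.GenericallyDiagonalizable A) :
    List.TFAE [
      StructSys.SFO A C F,
      (∀ i ∈ StructSys.functionalStates F, StructSys.OutputReachable A C i) ∧
        StructSys.grank (StructSys.stack A C) =
          StructSys.grank (StructSys.stack (StructSys.stack A C) F),
      (∀ i ∈ StructSys.functionalStates F, StructSys.OutputReachable A C i) ∧
        ∀ i ∈ StructSys.functionalStates F,
          StructSys.grank (StructSys.stack A C) =
            StructSys.grank (StructSys.stack (StructSys.stack A C) (StructSys.unitRow i)),
      (∀ i ∈ StructSys.functionalStates F, StructSys.OutputReachable A C i) ∧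
        ∀ i ∈ StructSys.functionalStates F,
          ¬ ∃ S : Set (Fin n), StructSys.IsMinimalDilation A C S ∧ i ∈ S] := by
  tfae_have 1 → 2 := fun h => ⟨fun _ hi => h.outputReachable hi, h.grank_eq⟩
  tfae_have 2 → 1 := fun h => StructSys.sFO_of_outputReachable_of_grank_eq hA h.1 h.2
  tfae_have 2 ↔ 3 := and_congr_right fun _ => StructSys.grank_eq_grank_stack_iff_unitRow _ _
  tfae_have 3 ↔ 4 := and_congr_right fun _ =>
    forall₂_congr fun i _ => StructSys.grank_unitRow_iff i
  tfae_finish
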